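/- For an odd integer $n>1$ and integers $c,d$, let $$(c,d)_n=\det\left[\left(\frac{i^2+cij+dj^2}{n}\right)\right]_{1\le i,j\le n-1},\qquad [c,d]_n=\det\left[\left(\frac{i^2+cij+dj^2}{n}\right)\right]_{0\le i,j\le n-1},$$ where $\left(\frac{\cdot}{n}\right)$ is the Jacobi symbol. An integer $a$ is called a quadratic residue modulo $n$ if $\gcd(a,n)=1$ and $x^2\equiv a\pmod n$ for some integer $x$. **Theorem.** Let $n>1$ be an odd integer. (i) If $-1$ is not a quadratic residue modulo $n$, then $(6,1)_n=(3,2)_n=0$ and $[6,1]_n=[3,2]_n=0$. (ii) If $-2$ is not a quadratic residue modulo $n$, then $(4,2)_n=(8,8)_n=0$ and $[4,2]_n=[8,8]_n=0$. (iii) If $-3$ is not a quadratic residue modulo $n$, then $(3,3)_n=(6,-3)_n=0$ and $[3,3]_n=[6,-3]_n=0$. (iv) If $-7$ is not a quadratic residue modulo $n$, then $(21,112)_n=(42,-7)_n=0$ and $[21,112]_n=[42,-7]_n=0$. -/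

import Mathlib

/-- `a` is a quadratic residue modulo `n`: `a` is relatively prime to `n`
and `x ^ 2 ≡ a (mod n)` for some integer `x`. -/
def IsQuadraticResidue (a : ℤ) (n : ℕ) : Prop :=
  IsCoprime a (n : ℤ) ∧ ∃ x : ℤ, x ^ 2 ≡ a [ZMOD (n : ℤ)]

/-- `(c, d)_n`: the determinant of the matrix of Jacobi symbols of `i² + cij + dj²` over `n`,
where `1 ≤ i, j ≤ n - 1`. -/
def roundDet (c d : ℤ) (n : ℕ) : ℤ :=
  (Matrix.of fun i j : Fin (n - 1) =>
    jacobiSym (((i : ℕ) + 1 : ℤ) ^ 2 + c * ((i : ℕ) + 1 : ℤ) * ((j : ℕ) + 1 : ℤ)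
      + d * ((j : ℕ) + 1 : ℤ) ^ 2) n).det

/-- `[c, d]_n`: the determinant of the matrix of Jacobi symbols of `i² + cij + dj²` over `n`,
where `0 ≤ i, j ≤ n - 1`. -/
def squareDet (c d : ℤ) (n : ℕ) : ℤ :=
  (Matrix.of fun i j : Fin n =>
    jacobiSym (((i : ℕ) : ℤ) ^ 2 + c * ((i : ℕ) : ℤ) * ((j : ℕ) : ℤ)
      + d * ((j : ℕ) : ℤ) ^ 2) n).det

open Finset

/-! If `p² ∣ n`, two rows coincide. If `n = p * m` is squarefree and `a` is not a residue, CRT lets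
`p` be chosen with `quadraticChar (ZMod p) a ≠ 1`. Weighting the rows divisible by `m` by the
character mod `p` gives a row relation as soon as `cubicCharSum (ZMod p) c d = 0`
(`dets_eq_zero_of_cubicCharSum`).

Up to sign this sum is the Frobenius trace of `y² = x (x² + c x + d)`, a curve with complex
multiplication by an order of `ℚ(√a)`; it vanishes when `a` is a nonresidue. For `-1`, `-2`, `-3` a
symmetry, a self-isogeny up to twist, or bijectivity of cubing proves this. For `-7` the
endomorphism is defined only over `𝔽_p(√-7)`, so the Hasse invariant is used: it is the sum mod `p`
up to sign, and the sum is smaller than `p`. The second pair `(c, d)` in each case follows by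
`cubicCharSum_isogeny` and a twist. -/

/-- The character sum of the cubic `x (x² + c x + d)` over a finite field. -/
def cubicCharSum (F : Type*) [Field F] [Fintype F] [DecidableEq F] (c d : F) : ℤ :=
  ∑ x : F, quadraticChar F (x * (x ^ 2 + c * x + d))

/-! ### Cubic character sums: isogeny, twists, and the cases -1, -2, -3. -/

section CharSum

variable {F : Type*} [Field F] [Fintype F] [DecidableEq F]

theorem quadraticChar_mul_sq {a : F} (ha : a ≠ 0) (b : F) :
    quadraticChar F (a ^ 2 * b) = quadraticChar F b := by
  rw [map_mul, quadraticChar_sq_one' ha, one_mul]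

theorem sum_roots_quadratic (hF : ringChar F ≠ 2) (u d : F) :
    (∑ x : F, if x ^ 2 - u * x + d = 0 then (1 : ℤ) else 0)
      = quadraticChar F (u ^ 2 - 4 * d) + 1 := by
  have h2 : (2 : F) ≠ 0 := Ring.two_ne_zero hF
  rw [← quadraticChar_card_sqrts hF, Finset.sum_boole]
  congr 1
  refine Finset.card_bij' (fun x _ => 2 * x - u) (fun y _ => (y + u) / 2) ?_ ?_ ?_ ?_
  · intro x hx
    simp only [mem_filter, mem_univ, true_and] at hx
    simp only [Set.mem_toFinset]
    change (2 * x - u) ^ 2 = _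
    linear_combination 4 * hx
  · intro y hy
    simp only [Set.mem_toFinset] at hy
    change y ^ 2 = _ at hy
    simp only [mem_filter, mem_univ, true_and]
    field_simp
    linear_combination hy
  · intro x _
    field_simp
    ring
  · intro y _
    field_simp
    ring

theorem sum_nonzero_roots_quadratic (hF : ringChar F ≠ 2) (u d : F) :
    (∑ x : F, if x ≠ 0 ∧ x ^ 2 - u * x + d = 0 then (1 : ℤ) else 0)
      = quadraticChar F (u ^ 2 - 4 * d) + 1 - if d = 0 then 1 else 0 := by
  rw [← sum_roots_quadratic hF u d, eq_sub_iff_add_eq]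
  rw [← Finset.add_sum_erase _ _ (mem_univ (0 : F)),
    ← Finset.add_sum_erase _ (fun x => if x ^ 2 - u * x + d = 0 then (1 : ℤ) else 0)
      (mem_univ (0 : F))]
  have : ∀ x ∈ (univ : Finset F).erase 0,
      (if x ≠ 0 ∧ x ^ 2 - u * x + d = 0 then (1 : ℤ) else 0)
        = if x ^ 2 - u * x + d = 0 then (1 : ℤ) else 0 := by
    intro x hx
    simp [Finset.ne_of_mem_erase hx]
  rw [Finset.sum_congr rfl this]
  simp
  ring

/-- The invariance of the character sum under the `2`-isogeny with kernel `{∞, (0, 0)}`. -/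
theorem cubicCharSum_isogeny (hF : ringChar F ≠ 2) (c d : F) :
    cubicCharSum F c d = cubicCharSum F (-2 * c) (c ^ 2 - 4 * d) := by
  -- With `u = x + d / x` the cubic equals `x² (u + c)`, so the sum can be grouped by `u`, each
  -- weighted by its number of nonzero preimages.
  have hx : ∀ x : F, quadraticChar F (x * (x ^ 2 + c * x + d))
      = ∑ u : F, quadraticChar F (u + c) *
          if x ≠ 0 ∧ x ^ 2 - u * x + d = 0 then (1 : ℤ) else 0 := by
    intro x
    by_cases h0 : x = 0
    · simp [h0]
    · rw [Finset.sum_eq_single (x + d / x)]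
      · rw [if_pos ⟨h0, by field_simp; ring⟩, mul_one, ← quadraticChar_mul_sq h0 (_ + c)]
        congr 1
        field_simp
        ring
      · intro u _ hu
        rw [if_neg, mul_zero]
        rintro ⟨-, h⟩
        apply hu
        field_simp
        linear_combination -h
      · simp
  have hshift : ∑ u : F, quadraticChar F (u + c) = 0 := by
    rw [← quadraticChar_sum_zero hF]
    exact Fintype.sum_equiv (Equiv.addRight c) _ _ fun _ => rfl
  unfold cubicCharSum
  simp_rw [hx]
  rw [Finset.sum_comm]
  simp_rw [← Finset.mul_sum, sum_nonzero_roots_quadratic hF]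
  have hsplit : ∀ u : F, quadraticChar F (u + c) *
      (quadraticChar F (u ^ 2 - 4 * d) + 1 - if d = 0 then 1 else 0)
      = quadraticChar F ((u + c) * (u ^ 2 - 4 * d))
        + quadraticChar F (u + c) * (1 - if d = 0 then 1 else 0) := by
    intro u
    rw [map_mul]
    ring
  simp_rw [hsplit]
  rw [Finset.sum_add_distrib, ← Finset.sum_mul, hshift, zero_mul, add_zero]
  refine Fintype.sum_equiv (Equiv.addRight c) _ _ fun u => ?_
  simp only [Equiv.coe_addRight]
  congr 1
  ring

theorem cubicCharSum_twist {t : F} (ht : t ≠ 0) (c d : F) :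
    cubicCharSum F (t * c) (t ^ 2 * d) = quadraticChar F t * cubicCharSum F c d := by
  unfold cubicCharSum
  rw [Finset.mul_sum]
  symm
  refine Fintype.sum_equiv (Equiv.mulLeft₀ t ht) _ _ fun x => ?_
  rw [← map_mul, ← quadraticChar_mul_sq ht (t * _)]
  congr 1
  change _ = t * x * ((t * x) ^ 2 + t * c * (t * x) + t ^ 2 * d)
  ring

theorem cubicCharSum_twist_eq_zero {t : F} (ht : t ≠ 0) {c d : F}
    (h : cubicCharSum F (t * c) (t ^ 2 * d) = 0) : cubicCharSum F c d = 0 := by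
  rw [cubicCharSum_twist ht] at h
  exact (mul_eq_zero.1 h).resolve_left fun h0 => ht (quadraticChar_eq_zero_iff.1 h0)

/-- The cubic is `x (x + 1) (x + 2)`, odd about `x = -1`. -/
theorem cubicCharSum_three_two (h : quadraticChar F (-1) ≠ 1) :
    cubicCharSum F 3 2 = 0 := by
  have hneg : quadraticChar F (-1) = -1 :=
    (quadraticChar_dichotomy (neg_ne_zero.2 one_ne_zero)).resolve_left h
  have hodd : cubicCharSum F 3 2 = -cubicCharSum F 3 2 := by
    rw [← neg_one_mul, ← hneg]
    unfold cubicCharSum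
    rw [Finset.mul_sum]
    refine Fintype.sum_equiv (Equiv.subLeft (-2)) _ _ fun x => ?_
    rw [← map_mul]
    congr 1
    simp only [Equiv.subLeft_apply]
    ring
  omega

theorem cubicCharSum_six_one (hF : ringChar F ≠ 2) (h : quadraticChar F (-1) ≠ 1) :
    cubicCharSum F 6 1 = 0 := by
  have h2 : (2 : F) ≠ 0 := Ring.two_ne_zero hF
  rw [cubicCharSum_isogeny hF]
  have h4 : (-4 : F) ≠ 0 := by
    have : (-4 : F) = -(2 * 2) := by norm_num
    rw [this]; exact neg_ne_zero.2 (mul_ne_zero h2 h2)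
  have := cubicCharSum_twist h4 3 2
  rw [cubicCharSum_three_two h, mul_zero] at this
  convert this using 2 <;> norm_num

/-- The isogenous curve `(-8, 8)` is the twist of `(4, 2)` by `-2`, so the sum equals its own
negative. -/
theorem cubicCharSum_four_two (hF : ringChar F ≠ 2) (h : quadraticChar F (-2) ≠ 1) :
    cubicCharSum F 4 2 = 0 := by
  have h2 : (-2 : F) ≠ 0 := neg_ne_zero.2 (Ring.two_ne_zero hF)
  have hneg : quadraticChar F (-2) = -1 := (quadraticChar_dichotomy h2).resolve_left h
  have h1 := cubicCharSum_isogeny hF 4 2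
  have h3 := cubicCharSum_twist h2 4 2
  rw [hneg] at h3
  have : cubicCharSum F (-2 * 4) (4 ^ 2 - 4 * 2) = cubicCharSum F (-2 * 4) ((-2) ^ 2 * 2) := by
    congr 1; norm_num
  omega

theorem cubicCharSum_eight_eight (hF : ringChar F ≠ 2) (h : quadraticChar F (-2) ≠ 1) :
    cubicCharSum F 8 8 = 0 := by
  apply cubicCharSum_twist_eq_zero (neg_ne_zero.2 one_ne_zero)
  have := cubicCharSum_four_two hF h
  rw [cubicCharSum_isogeny hF] at this
  convert this using 2 <;> norm_num

/-- A nontrivial cube root of unity `y / z` would yield a square root of `-3`; in characteristic 3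
that root is `0` and forces `y = z`. -/
theorem cube_injective (hF : ringChar F ≠ 2) (h : quadraticChar F (-3) ≠ 1) :
    Function.Injective fun x : F => x ^ 3 := by
  intro y z hyz
  simp only at hyz
  have h2 : (2 : F) ≠ 0 := Ring.two_ne_zero hF
  by_contra hne
  have hq : y ^ 2 + y * z + z ^ 2 = 0 := by
    apply (mul_eq_zero.1 _).resolve_left (sub_ne_zero.2 hne)
    linear_combination hyz
  have hz : z ≠ 0 := by
    rintro rfl
    apply hne
    simpa using hq
  have hsq : ((2 * y + z) / z) ^ 2 = -3 := by
    field_simp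
    linear_combination 4 * hq
  by_cases h3 : (-3 : F) = 0
  · have h0 : 2 * y + z = 0 := by
      rw [h3] at hsq
      simpa [hz] using hsq
    apply hne
    apply mul_left_cancel₀ h2
    linear_combination h0 + z * h3
  · apply h
    rw [← hsq, quadraticChar_sq_one']
    intro h0
    rw [h0] at hsq
    exact h3 (by rw [← hsq]; ring)

/-- The cubic is `(x + 1)³ - 1`, a permutation of `F`. -/
theorem cubicCharSum_three_three (hF : ringChar F ≠ 2) (h : quadraticChar F (-3) ≠ 1) :
    cubicCharSum F 3 3 = 0 := by
  let e : F ≃ F := (Equiv.addRight 1).trans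
    ((Equiv.ofBijective _ (Finite.injective_iff_bijective.1 (cube_injective hF h))).trans
      (Equiv.subRight 1))
  rw [← quadraticChar_sum_zero hF]
  refine Fintype.sum_equiv e _ _ fun x => ?_
  congr 1
  simp only [e, Equiv.trans_apply, Equiv.coe_addRight, Equiv.ofBijective_apply,
    Equiv.subRight_apply]
  ring

theorem cubicCharSum_six_neg_three (hF : ringChar F ≠ 2) (h : quadraticChar F (-3) ≠ 1) :
    cubicCharSum F 6 (-3) = 0 := by
  apply cubicCharSum_twist_eq_zero (neg_ne_zero.2 one_ne_zero)
  have := cubicCharSum_three_three hF h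
  rw [cubicCharSum_isogeny hF] at this
  convert this using 2 <;> norm_num

theorem cubicCharSum_zero_zero (hF : ringChar F ≠ 2) : cubicCharSum F 0 0 = 0 := by
  rw [← quadraticChar_sum_zero hF]
  refine Finset.sum_congr rfl fun x _ => ?_
  by_cases hx : x = 0
  · simp [hx]
  · rw [← quadraticChar_mul_sq hx x]
    congr 1
    ring

/-- The term at `x = 0` vanishes, whence a bound that is strict in the size of the field. -/
theorem abs_cubicCharSum_lt (c d : F) : |cubicCharSum F c d| < Fintype.card F := by
  unfold cubicCharSum
  rw [← Finset.add_sum_erase _ _ (mem_univ (0 : F))]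
  simp only [zero_mul, quadraticChar_zero, zero_add]
  calc _ ≤ ∑ x ∈ (univ : Finset F).erase 0, |quadraticChar F (x * (x ^ 2 + c * x + d))| :=
        Finset.abs_sum_le_sum_abs _ _
    _ ≤ ∑ x ∈ (univ : Finset F).erase 0, (1 : ℤ) := by
        refine Finset.sum_le_sum fun x _ => ?_
        rcases quadraticChar_isQuadratic F (x * (x ^ 2 + c * x + d)) with h | h | h <;> simp [h]
    _ < Fintype.card F := by
        rw [Finset.sum_const, nsmul_eq_mul, mul_one, Finset.card_erase_of_mem (mem_univ _),
          Finset.card_univ]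
        have := Fintype.card_pos (α := F)
        omega

end CharSum

/-! ### Hasse invariants and the case -7. -/

section HasseInvariant

open Polynomial

variable {p : ℕ} [Fact p.Prime] {K : Type*} [Field K]

theorem ZMod.sum_pow_of_lt {i : ℕ} (hi : i < 2 * (p - 1)) :
    ∑ x : ZMod p, x ^ i = if i = p - 1 then -1 else 0 := by
  have hp : 1 < p := (Fact.out : p.Prime).one_lt
  have hlow : ∀ k < p - 1, ∑ x : ZMod p, x ^ k = 0 := fun k hk =>
    FiniteField.sum_pow_lt_card_sub_one (ZMod p) k (by rwa [ZMod.card])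
  rcases lt_trichotomy i (p - 1) with h | rfl | h
  · rw [if_neg h.ne, hlow i h]
  · rw [if_pos rfl, ← Finset.add_sum_erase _ _ (mem_univ (0 : ZMod p))]
    rw [Finset.sum_congr rfl fun x hx => ZMod.pow_card_sub_one_eq_one (Finset.ne_of_mem_erase hx)]
    rw [zero_pow (by omega), zero_add, Finset.sum_const, Finset.card_erase_of_mem (mem_univ _),
      Finset.card_univ, ZMod.card, nsmul_eq_mul, Nat.cast_sub hp.le]
    simp
  · rw [if_neg h.ne', ← hlow (i - (p - 1)) (by omega)]
    refine Finset.sum_congr rfl fun x _ => ?_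
    obtain ⟨k, rfl⟩ := Nat.exists_eq_add_of_lt h
    rw [show p - 1 + k + 1 = p + k by omega, pow_add, ZMod.pow_card,
      show p + k - (p - 1) = k + 1 by omega, pow_succ']

theorem sum_eval_algebraMap_of_natDegree_lt [Algebra (ZMod p) K] {g : K[X]} (hg : g.natDegree < 2 * (p - 1)) :
    ∑ x : ZMod p, g.eval (algebraMap (ZMod p) K x) = -g.coeff (p - 1) := by
  have hp : 1 < p := (Fact.out : p.Prime).one_lt
  simp_rw [Polynomial.eval_eq_sum_range' hg]
  rw [Finset.sum_comm]
  simp_rw [← Finset.mul_sum, ← map_pow, ← map_sum]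
  rw [Finset.sum_eq_single (p - 1)]
  · rw [ZMod.sum_pow_of_lt (by omega), if_pos rfl]
    simp
  · intro i hi hne
    rw [ZMod.sum_pow_of_lt (Finset.mem_range.1 hi), if_neg hne]
    simp
  · intro h
    exact absurd (Finset.mem_range.2 (by omega)) h

theorem coeff_taylor_of_natDegree_lt [CharP K p] {g : K[X]}
    (hg : g.natDegree < 2 * (p - 1)) (a : K) :
    (taylor a g).coeff (p - 1) = g.coeff (p - 1) := by
  have hp : 1 < p := (Fact.out : p.Prime).one_lt
  rw [taylor_coeff, hasseDeriv_apply, Polynomial.sum_over_range' _ (by simp) _ hg,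
    Polynomial.eval_finsetSum, Finset.sum_eq_single (p - 1)]
  · simp
  · intro i hi hne
    have hi' := Finset.mem_range.1 hi
    -- For `p ≤ i < 2 * (p - 1)` the binomial coefficient is divisible by `p`.
    have h0 : ((i.choose (p - 1) : ℕ) : K) = 0 := by
      rcases lt_or_gt_of_ne hne with h | h
      · rw [Nat.choose_eq_zero_of_lt h, Nat.cast_zero]
      · rw [CharP.cast_eq_zero_iff K p]
        exact Nat.Prime.dvd_choose Fact.out (by omega) (by omega) (by omega)
    simp [h0]
  · intro h
    exact absurd (Finset.mem_range.2 (by omega)) h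

/-- The Hasse invariant in characteristic `p` of the curve `y² = x (x² + c x + d)`. -/
noncomputable def hasseInvariant (p : ℕ) {K : Type*} [Field K] (c d : K) : K :=
  ((X * (X ^ 2 + C c * X + C d)) ^ (p / 2) : K[X]).coeff (p - 1)

theorem natDegree_cubic_pow_lt (hp2 : p ≠ 2) (c d : K) :
    ((X * (X ^ 2 + C c * X + C d)) ^ (p / 2) : K[X]).natDegree < 2 * (p - 1) := by
  have h3 : (X * (X ^ 2 + C c * X + C d) : K[X]).natDegree ≤ 3 := by compute_degree
  have := natDegree_pow_le_of_le (p / 2) h3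
  have hp := (Fact.out : p.Prime).two_le
  obtain ⟨k, hk⟩ := (Fact.out : p.Prime).odd_of_ne_two hp2
  omega

theorem neg_hasseInvariant [Algebra (ZMod p) K] (hp2 : p ≠ 2) (c d : K) :
    -hasseInvariant p c d = ∑ x : ZMod p, (algebraMap (ZMod p) K x *
      (algebraMap (ZMod p) K x ^ 2 + c * algebraMap (ZMod p) K x + d)) ^ (p / 2) := by
  rw [hasseInvariant, ← sum_eval_algebraMap_of_natDegree_lt (natDegree_cubic_pow_lt hp2 c d)]
  simp

theorem cubicCharSum_cast (hp2 : p ≠ 2) (c d : ZMod p) :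
    (cubicCharSum (ZMod p) c d : ZMod p)
      = ∑ x : ZMod p, (x * (x ^ 2 + c * x + d)) ^ (p / 2) := by
  rw [cubicCharSum, Int.cast_sum]
  refine Finset.sum_congr rfl fun x _ => ?_
  rw [quadraticChar_eq_pow_of_char_ne_two' (by rwa [ZMod.ringChar_zmod_n]), ZMod.card]

/-- Moves another 2-torsion point to the origin. As `e` may lie outside the prime field, invariance
comes from the coefficient, not from reindexing the sum over `ZMod p`. -/
theorem hasseInvariant_translate [CharP K p] (hp2 : p ≠ 2) {c d e : K}
    (he : e ^ 2 + c * e + d = 0) :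
    hasseInvariant p c d = hasseInvariant p (3 * e + c) (3 * e ^ 2 + 2 * c * e + d) := by
  rw [hasseInvariant, hasseInvariant,
    ← coeff_taylor_of_natDegree_lt (natDegree_cubic_pow_lt hp2 c d) e, taylor_apply, pow_comp]
  congr 2
  simp only [mul_comp, add_comp, pow_comp, X_comp, C_comp, map_add, map_mul, map_pow, map_ofNat]
  have he' : (C e ^ 2 + C c * C e + C d : K[X]) = 0 := by
    rw [← map_pow, ← map_mul, ← map_add, ← map_add, he, map_zero]
  linear_combination C e * he'

theorem hasseInvariant_twist (hp2 : p ≠ 2) {t : K} (ht : t ≠ 0) (c d : K) :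
    hasseInvariant p (t * c) (t ^ 2 * d) = t ^ (p / 2) * hasseInvariant p c d := by
  have hodd := (Fact.out : p.Prime).odd_of_ne_two hp2
  have hcomp : ((X * (X ^ 2 + C (t * c) * X + C (t ^ 2 * d))) ^ (p / 2) : K[X]).comp (C t * X)
      = C ((t ^ 3) ^ (p / 2)) * (X * (X ^ 2 + C c * X + C d)) ^ (p / 2) := by
    rw [pow_comp, map_pow, ← mul_pow]
    congr 1
    simp only [mul_comp, add_comp, pow_comp, X_comp, C_comp, map_mul, map_pow]
    ring
  have h := congrArg (fun q => q.coeff (p - 1)) hcomp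
  simp only [comp_C_mul_X_coeff, coeff_C_mul] at h
  change hasseInvariant p (t * c) (t ^ 2 * d) * _ = _ * hasseInvariant p c d at h
  have h1 : p - 1 = 2 * (p / 2) := by obtain ⟨k, rfl⟩ := hodd; omega
  rw [h1] at h
  apply mul_right_cancel₀ (pow_ne_zero (2 * (p / 2)) ht)
  rw [h]
  ring

/-- A polynomial identity over the prime field between polynomials of low degree may be checked
on rational points. -/
theorem hasseInvariant_isogeny [Algebra (ZMod p) K] (hp2 : p ≠ 2) (c d : K) :
    hasseInvariant p c d = hasseInvariant p (-2 * c) (c ^ 2 - 4 * d) := by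
  have hF : ringChar (ZMod p) ≠ 2 := by rwa [ZMod.ringChar_zmod_n]
  -- The variables stand for `c` and `d`. Both cubics have degree at most 2 in each, so their powers
  -- have degree at most `p - 1`, just small enough for vanishing on all points to imply zero.
  let L : ZMod p → MvPolynomial (Fin 2) (ZMod p) := fun x =>
    MvPolynomial.C x * (MvPolynomial.C x ^ 2 + MvPolynomial.X 0 * MvPolynomial.C x
      + MvPolynomial.X 1)
  let R : ZMod p → MvPolynomial (Fin 2) (ZMod p) := fun x =>
    MvPolynomial.C x * (MvPolynomial.C x ^ 2 + MvPolynomial.C (-2) * MvPolynomial.X 0 *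
      MvPolynomial.C x + (MvPolynomial.X 0 ^ 2 - MvPolynomial.C 4 * MvPolynomial.X 1))
  let P : MvPolynomial (Fin 2) (ZMod p) := ∑ x, (L x ^ (p / 2) - R x ^ (p / 2))
  have hX : ∀ i j : Fin 2, (MvPolynomial.X j : MvPolynomial (Fin 2) (ZMod p)).degreeOf i ≤ 1 := by
    intro i j
    rw [MvPolynomial.degreeOf_X]
    split_ifs <;> simp
  have hCX : ∀ (i j : Fin 2) (a : ZMod p), (MvPolynomial.C a * MvPolynomial.X j).degreeOf i ≤ 1 :=
    fun i j a => (MvPolynomial.degreeOf_C_mul_le _ _ _).trans (hX i j)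
  have hL : ∀ x i, (L x).degreeOf i ≤ 2 := by
    intro x i
    refine (MvPolynomial.degreeOf_C_mul_le _ _ _).trans ?_
    refine (MvPolynomial.degreeOf_add_le _ _ _).trans (max_le ?_ ((hX i 1).trans one_le_two))
    refine (MvPolynomial.degreeOf_add_le _ _ _).trans (max_le ?_ ?_)
    · rw [← map_pow, MvPolynomial.degreeOf_C]
      exact zero_le_two
    · exact (MvPolynomial.degreeOf_mul_C_le _ _ _).trans ((hX i 0).trans one_le_two)
  have hR : ∀ x i, (R x).degreeOf i ≤ 2 := by
    intro x i
    refine (MvPolynomial.degreeOf_C_mul_le _ _ _).trans ?_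
    refine (MvPolynomial.degreeOf_add_le _ _ _).trans (max_le ?_ ?_)
    · refine (MvPolynomial.degreeOf_add_le _ _ _).trans (max_le ?_ ?_)
      · rw [← map_pow, MvPolynomial.degreeOf_C]
        exact zero_le_two
      · exact (MvPolynomial.degreeOf_mul_C_le _ _ _).trans ((hCX i 0 _).trans one_le_two)
    · refine (MvPolynomial.degreeOf_sub_le _ _ _).trans (max_le ?_ ((hCX i 1 _).trans one_le_two))
      exact (MvPolynomial.degreeOf_pow_le _ _ _).trans (Nat.mul_le_mul_left 2 (hX i 0))
  have hpow : ∀ (Q : MvPolynomial (Fin 2) (ZMod p)) (i : Fin 2), Q.degreeOf i ≤ 2 →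
      (Q ^ (p / 2)).degreeOf i ≤ p - 1 := by
    intro Q i hQ
    refine (MvPolynomial.degreeOf_pow_le _ _ _).trans ((Nat.mul_le_mul_left _ hQ).trans ?_)
    obtain ⟨k, hk⟩ := (Fact.out : p.Prime).odd_of_ne_two hp2
    omega
  have hP : P = 0 := by
    apply MvPolynomial.eq_zero_of_eval_eq_zero
    · intro v
      have h := congrArg (Int.cast : ℤ → ZMod p) (cubicCharSum_isogeny hF (v 0) (v 1))
      rw [cubicCharSum_cast hp2, cubicCharSum_cast hp2, ← sub_eq_zero,
        ← Finset.sum_sub_distrib] at h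
      rw [← h]
      simp [P, L, R]
    · rw [ZMod.card, MvPolynomial.mem_restrictDegree_iff_sup]
      intro i
      rw [← MvPolynomial.degreeOf_def]
      refine (MvPolynomial.degreeOf_sum_le _ _ _).trans (Finset.sup_le fun x _ => ?_)
      exact (MvPolynomial.degreeOf_sub_le _ _ _).trans
        (max_le (hpow _ _ (hL x i)) (hpow _ _ (hR x i)))
  have h := congrArg (MvPolynomial.aeval ![c, d]) hP
  have h2 : algebraMap (ZMod p) K 2 = 2 := map_ofNat _ 2
  have h4 : algebraMap (ZMod p) K 4 = 4 := map_ofNat _ 4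
  rw [← neg_inj, neg_hasseInvariant hp2, neg_hasseInvariant hp2, ← sub_eq_zero,
    ← Finset.sum_sub_distrib, ← map_zero (MvPolynomial.aeval (R := ZMod p) ![c, d]), ← h]
  simp [P, L, R, h2, h4]

/-- Complex multiplication by `(1 + √-7) / 2` forces the Hasse invariant to vanish when
the Frobenius map sends `√-7` to `-√-7`. -/
theorem hasseInvariant_twentyone [Algebra (ZMod p) K] [CharP K p] (hp2 : p ≠ 2) {w : K} (hw : w ^ 2 = -7)
    (hw0 : w ≠ 0) (hwp : w ^ p = -w) : hasseInvariant p (21 : K) 112 = 0 := by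
  have hK2 : (2 : K) ≠ 0 := Ring.two_ne_zero (by rwa [ringChar.eq_iff.2 ‹CharP K p›])
  obtain ⟨α, hα⟩ : ∃ α : K, 2 * α = 1 + w := ⟨(1 + w) / 2, by field_simp⟩
  have hw' : w = 2 * α - 1 := by rw [hα]; ring
  have hα2 : α ^ 2 = α - 2 := by
    apply mul_left_cancel₀ (mul_ne_zero hK2 hK2)
    rw [hw'] at hw
    linear_combination hw
  have hα0 : α ≠ 0 := by
    rintro rfl
    apply hK2
    linear_combination hα2
  have hαp : 2 * α ^ p = 1 - w := by
    have h2p : (2 : K) ^ p = 2 := by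
      have := congrArg (algebraMap (ZMod p) K) (ZMod.pow_card (2 : ZMod p))
      rwa [map_pow, map_ofNat] at this
    have := congrArg (· ^ p) hα
    simp only [mul_pow, add_pow_char, one_pow, hwp, h2p] at this
    rw [this]
    ring
  -- Dividing by the 2-torsion point at `α - 11`, then recentring at `9 * α - 22`, turns `(21, 112)`
  -- into its twist by `α²`: this is multiplication by `α`.
  have hcm : hasseInvariant p (21 : K) 112 = α ^ (2 * (p / 2)) * hasseInvariant p (21 : K) 112 := by
    rw [pow_mul, ← hasseInvariant_twist hp2 (pow_ne_zero 2 hα0)]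
    rw [hasseInvariant_translate hp2 (c := 21) (d := 112) (e := α - 11)
      (by linear_combination hα2)]
    rw [hasseInvariant_isogeny hp2]
    rw [hasseInvariant_translate hp2 (e := 9 * α - 22) (by linear_combination 24 * hα2)]
    congr 1
    · linear_combination -21 * hα2
    · linear_combination (244 - 112 * α ^ 2 - 112 * α) * hα2
  have h1 : p = 2 * (p / 2) + 1 := by
    obtain ⟨k, hk⟩ := (Fact.out : p.Prime).odd_of_ne_two hp2
    omega
  have h2 : α ^ p = α * α ^ (2 * (p / 2)) := by rw [← pow_succ', ← h1]
  refine (mul_eq_zero.1 (?_ : (2 * w) * hasseInvariant p (21 : K) 112 = 0)).resolve_left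
    (mul_ne_zero hK2 hw0)
  linear_combination 2 * α * hcm + hasseInvariant p (21 : K) 112 * (hαp - 2 * h2 - hα)

theorem cubicCharSum_twentyone (hp2 : p ≠ 2) (h : quadraticChar (ZMod p) (-7) ≠ 1) :
    cubicCharSum (ZMod p) 21 112 = 0 := by
  have hF : ringChar (ZMod p) ≠ 2 := by rwa [ZMod.ringChar_zmod_n]
  -- For `p = 7` the cubic degenerates to `x³`.
  by_cases h7 : (-7 : ZMod p) = 0
  · rw [← cubicCharSum_zero_zero hF]
    congr 1
    · linear_combination -3 * h7
    · linear_combination -16 * h7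
  have hneg := (quadraticChar_dichotomy h7).resolve_left h
  let K := AlgebraicClosure (ZMod p)
  have : CharP K p := charP_of_injective_algebraMap (algebraMap (ZMod p) K).injective p
  have h7K : algebraMap (ZMod p) K (-7) = -7 := by rw [map_neg, map_ofNat]
  obtain ⟨w, hw⟩ := IsAlgClosed.exists_pow_nat_eq (-7 : K) two_pos
  have hw0 : w ≠ 0 := by
    rintro rfl
    apply (map_ne_zero (algebraMap (ZMod p) K)).2 h7
    rw [h7K, ← hw]
    ring
  have hp1 : p = p / 2 * 2 + 1 := by
    obtain ⟨k, hk⟩ := (Fact.out : p.Prime).odd_of_ne_two hp2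
    omega
  have hwp : w ^ p = -w := by
    have h1 := congrArg (algebraMap (ZMod p) K) (quadraticChar_eq_pow_of_char_ne_two' hF (-7))
    rw [hneg, ZMod.card, map_pow, h7K, ← hw, ← pow_mul, map_intCast] at h1
    calc w ^ p = w ^ (2 * (p / 2) + 1) := by congr 1; omega
      _ = -w := by rw [pow_succ, ← h1, Int.cast_neg, Int.cast_one, neg_one_mul]
  have hH := hasseInvariant_twentyone hp2 hw hw0 hwp
  have hcast : (cubicCharSum (ZMod p) 21 112 : ZMod p) = 0 := by
    have h21 : algebraMap (ZMod p) K 21 = 21 := map_ofNat _ 21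
    have h112 : algebraMap (ZMod p) K 112 = 112 := map_ofNat _ 112
    apply (algebraMap (ZMod p) K).injective
    rw [cubicCharSum_cast hp2, map_zero, ← neg_zero, ← hH, neg_hasseInvariant hp2]
    simp [h21, h112]
  rw [ZMod.intCast_zmod_eq_zero_iff_dvd] at hcast
  apply Int.eq_zero_of_abs_lt_dvd hcast
  simpa using abs_cubicCharSum_lt (21 : ZMod p) 112

theorem cubicCharSum_fortytwo (hp2 : p ≠ 2) (h : quadraticChar (ZMod p) (-7) ≠ 1) :
    cubicCharSum (ZMod p) 42 (-7) = 0 := by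
  apply cubicCharSum_twist_eq_zero (neg_ne_zero.2 one_ne_zero)
  have := cubicCharSum_twentyone hp2 h
  rw [cubicCharSum_isogeny (by rwa [ZMod.ringChar_zmod_n])] at this
  convert this using 2 <;> norm_num

end HasseInvariant

/-! ### From residues and character sums to the determinants. -/

theorem IsQuadraticResidue.mul {a : ℤ} {x y : ℕ} (hxy : x.Coprime y)
    (hx : IsQuadraticResidue a x) (hy : IsQuadraticResidue a y) :
    IsQuadraticResidue a (x * y) := by
  obtain ⟨hcx, s, hs⟩ := hx
  obtain ⟨hcy, t, ht⟩ := hy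
  obtain ⟨u, v, huv⟩ := Nat.isCoprime_iff_coprime.2 hxy
  rw [IsQuadraticResidue, Nat.cast_mul]
  refine ⟨hcx.mul_right hcy, s * (v * y) + t * (u * x),
    (Int.modEq_and_modEq_iff_modEq_mul (by simpa using hxy)).1 ⟨?_, ?_⟩⟩
  · refine Int.ModEq.trans (Int.ModEq.pow 2 (Int.modEq_iff_dvd.2 ⟨(s - t) * u, ?_⟩)) hs
    linear_combination -s * huv
  · refine Int.ModEq.trans (Int.ModEq.pow 2 (Int.modEq_iff_dvd.2 ⟨(t - s) * v, ?_⟩)) ht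
    linear_combination -t * huv

theorem isQuadraticResidue_of_quadraticChar {p : ℕ} [Fact p.Prime] {a : ℤ}
    (h : quadraticChar (ZMod p) (a : ZMod p) = 1) : IsQuadraticResidue a p := by
  have ha : (a : ZMod p) ≠ 0 := by
    intro h0
    simp [h0] at h
  constructor
  · refine ((Nat.prime_iff_prime_int.1 Fact.out).irreducible.coprime_iff_not_dvd.2 ?_).symm
    rwa [← ZMod.intCast_zmod_eq_zero_iff_dvd]
  · obtain ⟨y, hy⟩ := (quadraticChar_one_iff_isSquare ha).1 h
    obtain ⟨x, rfl⟩ := ZMod.intCast_surjective y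
    refine ⟨x, (ZMod.intCast_eq_intCast_iff _ _ p).1 ?_⟩
    rw [hy]
    push_cast
    ring

theorem exists_prime_quadraticChar_ne_one {n : ℕ} (hn : Squarefree n) {a : ℤ}
    (ha : ¬ IsQuadraticResidue a n) :
    ∃ (p : ℕ) (_ : Fact p.Prime), p ∣ n ∧ quadraticChar (ZMod p) (a : ZMod p) ≠ 1 := by
  by_contra! hall
  apply ha
  clear ha
  induction n using Nat.recOnPosPrimePosCoprime with
  | zero => exact absurd hn not_squarefree_zero
  | one => exact ⟨by simpa using isCoprime_one_right, 0, by simpa using Int.modEq_one⟩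
  | prime_pow p k hp hk =>
    have : Fact p.Prime := ⟨hp⟩
    rcases hn.eq_zero_or_one_of_pow_of_not_isUnit hp.not_isUnit with rfl | rfl
    · exact absurd hk (lt_irrefl 0)
    · rw [pow_one] at hall ⊢
      exact isQuadraticResidue_of_quadraticChar (hall p this dvd_rfl)
  | coprime x y _ _ hxy ihx ihy =>
    exact IsQuadraticResidue.mul hxy
      (ihx (hn.squarefree_of_dvd (dvd_mul_right x y)) fun p hp h => hall p hp (h.mul_right y))
      (ihy (hn.squarefree_of_dvd (dvd_mul_left y x)) fun p hp h => hall p hp (h.mul_left x))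

/-- A row relation with coefficients vanishing at `0` kills both determinants. -/
theorem dets_eq_zero_of_row_relation {n : ℕ} {c d : ℤ} (u : ℕ → ℤ) (h0 : u 0 = 0)
    (hne : ∃ i < n, u i ≠ 0)
    (hrel : ∀ j : ℕ, ∑ i ∈ range n,
      u i * jacobiSym ((i : ℤ) ^ 2 + c * i * j + d * (j : ℤ) ^ 2) n = 0) :
    roundDet c d n = 0 ∧ squareDet c d n = 0 := by
  obtain ⟨i₀, hi₀, hu⟩ := hne
  constructor
  · obtain ⟨k, rfl⟩ : ∃ k, i₀ = k + 1 := Nat.exists_eq_succ_of_ne_zero (by rintro rfl; exact hu h0)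
    refine Matrix.exists_vecMul_eq_zero_iff.1 ⟨fun i : Fin (n - 1) => u (i + 1), ?_, ?_⟩
    · intro h
      exact hu (congrFun h ⟨k, by omega⟩)
    · funext j
      have h := hrel (j + 1)
      have hn : range n = range (n - 1 + 1) := by rw [Nat.sub_add_cancel (by omega)]
      rw [hn, Finset.sum_range_succ', h0, zero_mul, add_zero, Finset.sum_range] at h
      simpa [Matrix.vecMul, dotProduct] using h
  · refine Matrix.exists_vecMul_eq_zero_iff.1 ⟨fun i : Fin n => u i, ?_, ?_⟩
    · intro h
      exact hu (congrFun h ⟨i₀, hi₀⟩)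
    · funext j
      have h := hrel j
      rw [Finset.sum_range] at h
      simpa [Matrix.vecMul, dotProduct] using h

theorem jacobiSym_congr {a b : ℤ} {n : ℕ} (h : a ≡ b [ZMOD n]) : jacobiSym a n = jacobiSym b n :=
  jacobiSym.mod_left' h

/-- For `n = p * p * s` the Jacobi symbol has period `p * s`, so rows `1` and `1 + p * s` agree; row
`0` is avoided because `roundDet` lacks it. -/
theorem dets_eq_zero_of_not_squarefree {n : ℕ} (hodd : Odd n) (hn : ¬ Squarefree n) (c d : ℤ) :
    roundDet c d n = 0 ∧ squareDet c d n = 0 := by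
  obtain ⟨p, hp, s, rfl⟩ : ∃ p, p.Prime ∧ p * p ∣ n := by
    rw [Nat.squarefree_iff_prime_squarefree] at hn
    push Not at hn
    exact hn
  have hp2 : 2 < p := by
    refine lt_of_le_of_ne hp.two_le ?_
    rintro rfl
    exact (Nat.not_even_iff_odd.2 hodd) ⟨2 * s, by ring⟩
  have hs : 0 < s := Nat.pos_of_ne_zero (by rintro rfl; simp at hodd)
  have hps : p * s ≠ 0 := by positivity
  have hper : ∀ j : ℕ, jacobiSym (((1 + p * s : ℕ) : ℤ) ^ 2 + c * ((1 + p * s : ℕ) : ℤ) * j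
      + d * (j : ℤ) ^ 2) (p * p * s) = jacobiSym (((1 : ℕ) : ℤ) ^ 2 + c * ((1 : ℕ) : ℤ) * j
      + d * (j : ℤ) ^ 2) (p * p * s) := by
    intro j
    have hmod : (((1 + p * s : ℕ) : ℤ) ^ 2 + c * ((1 + p * s : ℕ) : ℤ) * j + d * (j : ℤ) ^ 2)
        ≡ (((1 : ℕ) : ℤ) ^ 2 + c * ((1 : ℕ) : ℤ) * j + d * (j : ℤ) ^ 2) [ZMOD (p * s : ℕ)] := by
      have h1 : ((1 + p * s : ℕ) : ℤ) ≡ ((1 : ℕ) : ℤ) [ZMOD (p * s : ℕ)] := by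
        push_cast
        exact Int.modEq_iff_dvd.2 ⟨-1, by ring⟩
      gcongr
    rw [mul_assoc p p s, jacobiSym.mul_right' _ (b₂ := p * s) hp.ne_zero hps,
      jacobiSym.mul_right' _ (b₂ := p * s) hp.ne_zero hps, jacobiSym_congr hmod,
      jacobiSym_congr (hmod.of_dvd ⟨s, by push_cast; ring⟩)]
  have hlt : 1 + p * s < p * p * s := by nlinarith [Nat.mul_pos hp.pos hs]
  refine dets_eq_zero_of_row_relation
    (fun i => (if i = 1 then 1 else 0) - if i = 1 + p * s then 1 else 0) ?_ ⟨1, by omega, ?_⟩ ?_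
  · simp [show 0 ≠ 1 + p * s by omega]
  · simp [hp.ne_zero, hs.ne']
  · intro j
    simp only [sub_mul, ite_mul, one_mul, zero_mul]
    rw [Finset.sum_sub_distrib, Finset.sum_ite_eq', Finset.sum_ite_eq',
      if_pos (Finset.mem_range.2 (by omega)), if_pos (Finset.mem_range.2 hlt), hper, sub_self]

/-- By homogeneity, `x ↦ y * x` reduces `y ≠ 0` to the cubic sum; `y = 0` leaves the sum of `x³`. -/
theorem sum_quadraticChar_mul_form {F : Type*} [Field F] [Fintype F] [DecidableEq F]
    (hF : ringChar F ≠ 2) {c d : F} (h : cubicCharSum F c d = 0) (y : F) :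
    ∑ x : F, quadraticChar F x * quadraticChar F (x ^ 2 + c * x * y + d * y ^ 2) = 0 := by
  by_cases hy : y = 0
  · rw [← cubicCharSum_zero_zero hF]
    refine Finset.sum_congr rfl fun x _ => ?_
    rw [← map_mul, hy]
    congr 1
    ring
  · have hsum : ∑ x : F, quadraticChar F x * quadraticChar F (x ^ 2 + c * x * y + d * y ^ 2)
        = quadraticChar F y * cubicCharSum F c d := by
      rw [cubicCharSum, Finset.mul_sum]
      symm
      refine Fintype.sum_equiv (Equiv.mulLeft₀ y hy) _ _ fun x => ?_
      rw [← map_mul, ← map_mul, ← quadraticChar_mul_sq hy (y * _)]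
      congr 1
      change _ = y * x * ((y * x) ^ 2 + c * (y * x) * y + d * y ^ 2)
      ring
    rw [hsum, h, mul_zero]

theorem sum_range_multiples {p m : ℕ} [Fact p.Prime] (hpm : ¬ p ∣ m) (f : ZMod p → ℤ) :
    ∑ i ∈ range (p * m), (if m ∣ i then f (i : ZMod p) else 0) = ∑ x, f x := by
  have hm : 0 < m := Nat.pos_of_ne_zero (by rintro rfl; simp at hpm)
  have hm' : (m : ZMod p) ≠ 0 := by rwa [Ne, ZMod.natCast_eq_zero_iff]
  rw [← Finset.sum_filter]
  symm
  refine Finset.sum_nbij' (fun x => m * ((m : ZMod p)⁻¹ * x).val) (fun i => (i : ZMod p))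
    ?_ ?_ ?_ ?_ ?_
  · intro x _
    simp only [mem_filter, mem_range, dvd_mul_right, and_true]
    rw [mul_comm]
    exact Nat.mul_lt_mul_of_pos_right (ZMod.val_lt _) hm
  · simp
  · intro x _
    simp [hm']
  · intro i hi
    simp only [mem_filter, mem_range] at hi
    obtain ⟨hi, k, rfl⟩ := hi
    have hk : k < p := by
      rw [mul_comm] at hi
      exact lt_of_mul_lt_mul_right hi hm.le
    rw [Nat.cast_mul, inv_mul_cancel_left₀ hm', ZMod.val_cast_of_lt hk]
  · intro x _
    simp [hm']

theorem dets_eq_zero_of_cubicCharSum {n p : ℕ} [Fact p.Prime] (hp2 : p ≠ 2) (hn : Squarefree n)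
    (hpn : p ∣ n) {c d : ℤ} (h : cubicCharSum (ZMod p) (c : ZMod p) (d : ZMod p) = 0) :
    roundDet c d n = 0 ∧ squareDet c d n = 0 := by
  obtain ⟨m, rfl⟩ := hpn
  have hp : p.Prime := Fact.out
  have hpm : ¬ p ∣ m := by
    rintro ⟨k, rfl⟩
    exact hp.not_isUnit (hn p ⟨k, by ring⟩)
  have hm : 0 < m := Nat.pos_of_ne_zero (by rintro rfl; simp at hpm)
  refine dets_eq_zero_of_row_relation
    (fun i => if m ∣ i then quadraticChar (ZMod p) (i : ZMod p) else 0) (by simp) ⟨m, ?_, ?_⟩ ?_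
  · nlinarith [hp.two_le]
  · rw [if_pos dvd_rfl, Ne, quadraticChar_eq_zero_iff, ZMod.natCast_eq_zero_iff]
    exact hpm
  · intro j
    -- On rows with `m ∣ i` the form is `d * j²` mod `m`, so the symbol mod `m` factors out; these
    -- `i` represent every class mod `p` once.
    have hterm : ∀ i : ℕ, (if m ∣ i then quadraticChar (ZMod p) (i : ZMod p) else 0) *
        jacobiSym ((i : ℤ) ^ 2 + c * i * j + d * (j : ℤ) ^ 2) (p * m)
        = (if m ∣ i then quadraticChar (ZMod p) (i : ZMod p) * quadraticChar (ZMod p)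
            ((i : ZMod p) ^ 2 + c * i * j + d * (j : ZMod p) ^ 2) else 0)
          * jacobiSym (d * (j : ℤ) ^ 2) m := by
      intro i
      split_ifs with hi
      · have hmod : (i : ℤ) ^ 2 + c * i * j + d * (j : ℤ) ^ 2 ≡ d * (j : ℤ) ^ 2 [ZMOD m] := by
          obtain ⟨k, rfl⟩ := hi
          exact Int.modEq_iff_dvd.2 ⟨-(m * k ^ 2 + c * k * j), by push_cast; ring⟩
        rw [jacobiSym.mul_right' _ hp.ne_zero hm.ne', jacobiSym_congr hmod,
          ← jacobiSym.legendreSym.to_jacobiSym, legendreSym]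
        push_cast
        ring
      · simp
    simp_rw [hterm]
    rw [← Finset.sum_mul, sum_range_multiples hpm (fun x => quadraticChar (ZMod p) x *
      quadraticChar (ZMod p) (x ^ 2 + c * x * j + d * (j : ZMod p) ^ 2)),
      sum_quadraticChar_mul_form (by rwa [ZMod.ringChar_zmod_n]) h, zero_mul]

theorem dets_eq_zero_of_not_isQuadraticResidue {n : ℕ} (hodd : Odd n) {a c d : ℤ}
    (ha : ¬ IsQuadraticResidue a n)
    (h : ∀ (p : ℕ) [Fact p.Prime], p ≠ 2 → quadraticChar (ZMod p) (a : ZMod p) ≠ 1 →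
      cubicCharSum (ZMod p) (c : ZMod p) (d : ZMod p) = 0) :
    roundDet c d n = 0 ∧ squareDet c d n = 0 := by
  by_cases hn : Squarefree n
  · obtain ⟨p, hp, hpn, hpa⟩ := exists_prime_quadraticChar_ne_one hn ha
    have hp2 : p ≠ 2 := by
      rintro rfl
      exact (Nat.not_even_iff_odd.2 hodd) (even_iff_two_dvd.2 hpn)
    exact dets_eq_zero_of_cubicCharSum hp2 hn hpn (h p hp2 hpa)
  · exact dets_eq_zero_of_not_squarefree hodd hn c d

theorem theorem1p1 (n : ℕ) (hn : 1 < n) (hodd : Odd n) :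
    (¬ IsQuadraticResidue (-1) n →
      (roundDet 6 1 n = 0 ∧ roundDet 3 2 n = 0) ∧
      (squareDet 6 1 n = 0 ∧ squareDet 3 2 n = 0)) ∧
    (¬ IsQuadraticResidue (-2) n →
      (roundDet 4 2 n = 0 ∧ roundDet 8 8 n = 0) ∧
      (squareDet 4 2 n = 0 ∧ squareDet 8 8 n = 0)) ∧
    (¬ IsQuadraticResidue (-3) n →
      (roundDet 3 3 n = 0 ∧ roundDet 6 (-3) n = 0) ∧
      (squareDet 3 3 n = 0 ∧ squareDet 6 (-3) n = 0)) ∧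
    (¬ IsQuadraticResidue (-7) n →
      (roundDet 21 112 n = 0 ∧ roundDet 42 (-7) n = 0) ∧
      (squareDet 21 112 n = 0 ∧ squareDet 42 (-7) n = 0)) := by
  have hchar : ∀ p : ℕ, p ≠ 2 → ringChar (ZMod p) ≠ 2 := fun p hp2 => by
    rwa [ZMod.ringChar_zmod_n]
  refine ⟨fun ha => ?_, fun ha => ?_, fun ha => ?_, fun ha => ?_⟩
  · obtain ⟨h1, h2⟩ := dets_eq_zero_of_not_isQuadraticResidue (c := 6) (d := 1) hodd ha
      fun p _ hp2 h => by
        simpa using cubicCharSum_six_one (hchar p hp2) (by simpa using h)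
    obtain ⟨h3, h4⟩ := dets_eq_zero_of_not_isQuadraticResidue (c := 3) (d := 2) hodd ha
      fun p _ hp2 h => by
        simpa using cubicCharSum_three_two (by simpa using h)
    exact ⟨⟨h1, h3⟩, h2, h4⟩
  · obtain ⟨h1, h2⟩ := dets_eq_zero_of_not_isQuadraticResidue (c := 4) (d := 2) hodd ha
      fun p _ hp2 h => by
        simpa using cubicCharSum_four_two (hchar p hp2) (by simpa using h)
    obtain ⟨h3, h4⟩ := dets_eq_zero_of_not_isQuadraticResidue (c := 8) (d := 8) hodd ha
      fun p _ hp2 h => by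
        simpa using cubicCharSum_eight_eight (hchar p hp2) (by simpa using h)
    exact ⟨⟨h1, h3⟩, h2, h4⟩
  · obtain ⟨h1, h2⟩ := dets_eq_zero_of_not_isQuadraticResidue (c := 3) (d := 3) hodd ha
      fun p _ hp2 h => by
        simpa using cubicCharSum_three_three (hchar p hp2) (by simpa using h)
    obtain ⟨h3, h4⟩ := dets_eq_zero_of_not_isQuadraticResidue (c := 6) (d := -3) hodd ha
      fun p _ hp2 h => by
        simpa using cubicCharSum_six_neg_three (hchar p hp2) (by simpa using h)
    exact ⟨⟨h1, h3⟩, h2, h4⟩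
  · obtain ⟨h1, h2⟩ := dets_eq_zero_of_not_isQuadraticResidue (c := 21) (d := 112) hodd ha
      fun p _ hp2 h => by
        simpa using cubicCharSum_twentyone hp2 (by simpa using h)
    obtain ⟨h3, h4⟩ := dets_eq_zero_of_not_isQuadraticResidue (c := 42) (d := -7) hodd ha
      fun p _ hp2 h => by
        simpa using cubicCharSum_fortytwo hp2 (by simpa using h)
    exact ⟨⟨h1, h3⟩, h2, h4⟩
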